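/- Let $K$ be a field, $V$ a $K$-vector space of finite dimension $n$, and $[\ ]$ a bracket on $V$, that is, a nondegenerate (equivalently, nonzero) alternating $n$-linear form on $V$. On the exterior algebra $\Lambda(V)$ write $\vee$ (join) for the exterior product, $\Delta(X)=\sum_{(X)}X_{(1)}\otimes X_{(2)}$ for the usual coproduct (the algebra homomorphism into the graded tensor square with $\Delta(v)=v\otimes 1+1\otimes v$ for $v\in V$), and $[x_1\vee\cdots\vee x_n]=[x_1,\dots,x_n]$. The meet $\wedge$ is the bilinear operation on $\Lambda(V)$ such that, for extensors (products of vectors; in step $0$, scalars) $X,Y$ of steps $a,b$, $$X\wedge Y=\sum_{(X)_{(n-b,\,a+b-n)}}[X_{(1)}\vee Y]\,X_{(2)}\quad\text{if } a+b\ge n,\qquad X\wedge Y=0\quad\text{if } a+b<n,$$ where the sum is over the component of $\Delta(X)$ in $\Lambda^{n-b}(V)\otimes\Lambda^{a+b-n}(V)$. Let $r\ge 1$, let $C_1,\dots,C_r$ be extensors of steps $n-q_1>0,\dots,n-q_r>0$ with $q_1,\dots,q_r>0$ integers, and put $p=q_1+\cdots+q_r$. Let $A$ and $B$ be extensors of steps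 $s$ and $k$ with $s+k=p$. Then $$(A\vee B)\wedge(C_1\wedge\cdots\wedge C_r)=A\wedge\sum_{(i_1,\dots,i_r)}\varepsilon_{i_1,\dots,i_r}\sum_{(B)}(B_{(1)}\vee C_1)\wedge\cdots\wedge(B_{(r)}\vee C_r),$$ where the first sum is over all $r$-tuples of integers with $0\le i_h\le q_h$ for all $h$ and $i_1+\cdots+i_r=s$, the second sum is over the slices of $B$ of type $(q_1-i_1,\dots,q_r-i_r)$, that is, over the component $\sum_{(B)}B_{(1)}\otimes\cdots\otimes B_{(r)}$ of the $r$-fold iterated coproduct of $B$ in $\Lambda^{q_1-i_1}(V)\otimes\cdots\otimes\Lambda^{q_r-i_r}(V)$, and $$\varepsilon_{i_1,\dots,i_r}=(-1)^{\sum_{r\ge h>l\ge 1}i_h(q_l-i_l)}.$$ (Iterated meets are nested from left to right.) -/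

import Mathlib

open scoped TensorProduct

noncomputable section

namespace CayleyGrassmann

variable {K : Type*} [Field K] {V : Type*} [AddCommGroup V] [Module K V]

/-- `A` is an extensor of step `j`: up to a scalar, a product of `j` vectors (the scalar matters only
for `j = 0`, where the extensors are the scalars). -/
def IsExtensor (j : ℕ) (A : ExteriorAlgebra K V) : Prop :=
  ∃ (c : K) (v : Fin j → V), A = c • ExteriorAlgebra.ιMulti K j v

/-- The tensor square of `Λ(V)` in the category of graded algebras, whose product is
`(A₁ ⊗ A₂)(B₁ ⊗ B₂) = (-1)^(a₂ b₁) A₁B₁ ⊗ A₂B₂`. -/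
abbrev GradedSquare (K : Type*) [Field K] (V : Type*) [AddCommGroup V] [Module K V] : Type _ :=
  GradedTensorProduct K (fun i : ℕ => ⋀[K]^i V) (fun i : ℕ => ⋀[K]^i V)

/-- `v ↦ v ⊗ 1 + 1 ⊗ v`. -/
def primitive (K : Type*) [Field K] (V : Type*) [AddCommGroup V] [Module K V] :
    V →ₗ[K] GradedSquare K V :=
  (GradedTensorProduct.includeLeft (fun i : ℕ => ⋀[K]^i V)
      (fun i : ℕ => ⋀[K]^i V)).toLinearMap ∘ₗ ExteriorAlgebra.ι K +
    (GradedTensorProduct.includeRight (fun i : ℕ => ⋀[K]^i V)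
      (fun i : ℕ => ⋀[K]^i V)).toLinearMap ∘ₗ ExteriorAlgebra.ι K

theorem primitive_mul_self (v : V) : primitive K V v * primitive K V v = 0 := by
  have hι : ExteriorAlgebra.ι K v ∈ ⋀[K]^1 V := by
    simp
  have h := GradedTensorProduct.tmul_coe_mul_coe_tmul (R := K) (fun i : ℕ => ⋀[K]^i V)
    (fun i : ℕ => ⋀[K]^i V) 1 ⟨_, hι⟩ ⟨_, hι⟩ 1
  have h11 := GradedTensorProduct.tmul_one_mul_coe_tmul (R := K) (fun i : ℕ => ⋀[K]^i V)
    (fun i : ℕ => ⋀[K]^i V) (ExteriorAlgebra.ι K v) ⟨_, hι⟩ 1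
  have h22 := GradedTensorProduct.tmul_coe_mul_one_tmul (R := K) (fun i : ℕ => ⋀[K]^i V)
    (fun i : ℕ => ⋀[K]^i V) 1 ⟨_, hι⟩ (ExteriorAlgebra.ι K v)
  have h12 := GradedTensorProduct.tmul_one_mul_one_tmul (R := K) (fun i : ℕ => ⋀[K]^i V)
    (fun i : ℕ => ⋀[K]^i V) (ExteriorAlgebra.ι K v) (ExteriorAlgebra.ι K v)
  simp only [ExteriorAlgebra.ι_sq_zero, mul_one, one_mul, pow_one] at h h11 h22 h12
  simp only [primitive, LinearMap.add_apply, LinearMap.comp_apply, AlgHom.toLinearMap_apply,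
    GradedTensorProduct.includeLeft_apply, GradedTensorProduct.includeRight_apply, add_mul, mul_add,
    h, h11, h22, h12]
  simp [GradedTensorProduct.tmul]

/-- The coproduct of `Λ(V)`, as a homomorphism of algebras into the graded tensor square: the
one with `Δ v = v ⊗ 1 + 1 ⊗ v` for every vector `v`. -/
def coproductHom (K : Type*) [Field K] (V : Type*) [AddCommGroup V] [Module K V] :
    ExteriorAlgebra K V →ₐ[K] GradedSquare K V :=
  ExteriorAlgebra.lift K ⟨primitive K V, primitive_mul_self⟩

/-- The coproduct `Δ A = ∑ A₍₁₎ ⊗ A₍₂₎` as a linear map into the tensor square. -/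
def coproduct (K : Type*) [Field K] (V : Type*) [AddCommGroup V] [Module K V] :
    ExteriorAlgebra K V →ₗ[K] ExteriorAlgebra K V ⊗[K] ExteriorAlgebra K V :=
  (GradedTensorProduct.of K (fun i : ℕ => ⋀[K]^i V)
      (fun i : ℕ => ⋀[K]^i V)).symm.toLinearMap ∘ₗ (coproductHom K V).toLinearMap

/-- The iterated coproduct `A ↦ ∑ A₍₁₎ ⊗ ⋯ ⊗ A₍ₘ₊₁₎`, by `Δ⁽¹⁾ = id` and
`Δ⁽ʳ⁺¹⁾ = (Δ⁽ʳ⁾ ⊗ id) ∘ Δ`. -/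
def iteratedCoproduct (K : Type*) [Field K] (V : Type*) [AddCommGroup V] [Module K V] :
    (m : ℕ) → ExteriorAlgebra K V →ₗ[K] ⨂[K]^(m + 1) (ExteriorAlgebra K V)
  | 0 =>
    (PiTensorProduct.subsingletonEquiv (R := K)
      (s := fun _ : Fin 1 => ExteriorAlgebra K V) 0).symm.toLinearMap
  | m + 1 =>
    (TensorPower.mulEquiv (n := m + 1) (m := 1)).toLinearMap ∘ₗ
      TensorProduct.map (iteratedCoproduct K V m)
        (PiTensorProduct.subsingletonEquiv (R := K)
          (s := fun _ : Fin 1 => ExteriorAlgebra K V) 0).symm.toLinearMap ∘ₗ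
      coproduct K V

/-- The coproduct slice of `B` of type `(j₀, …, jₘ)`: the component of the iterated coproduct of
`B` in `Λ^{j₀}(V) ⊗ ⋯ ⊗ Λ^{jₘ}(V)`. -/
def slice {m : ℕ} (j : Fin (m + 1) → ℕ) (B : ExteriorAlgebra K V) :
    ⨂[K]^(m + 1) (ExteriorAlgebra K V) :=
  PiTensorProduct.map (fun h => GradedAlgebra.proj (fun i : ℕ => ⋀[K]^i V) (j h))
    (iteratedCoproduct K V m B)

/-- The Sweedler sum `∑_(B) Φ(B₍₁₎, …, B₍ₘ₊₁₎)` of a multilinear expression `Φ` over the slices of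
`B` of type `(j₀, …, jₘ)`. -/
def sweedlerSum {m : ℕ} (j : Fin (m + 1) → ℕ)
    (Φ : MultilinearMap K (fun _ : Fin (m + 1) => ExteriorAlgebra K V) (ExteriorAlgebra K V))
    (B : ExteriorAlgebra K V) : ExteriorAlgebra K V :=
  PiTensorProduct.lift Φ (slice j B)

/-- The bracket `[x₁ ⋯ xₙ] = [x₁, …, xₙ]` on `Λⁿ(V)`, extended by zero to the other steps. -/
def bracketForm {n : ℕ} (br : V [⋀^Fin n]→ₗ[K] K) : ExteriorAlgebra K V →ₗ[K] K :=
  ExteriorAlgebra.liftAlternating (Pi.single n br)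

/-- The meet `A ∧ B = ∑ [A₍₁₎ B] A₍₂₎`, bilinear in `A` and `B`. If `A`, `B` are extensors of steps
`a`, `b`, then `[A₍₁₎ B]` vanishes unless `A₍₁₎` has step `n - b`, so that the sum runs over the
slice of `A` of type `(n - b, a + b - n)`, and it is zero when `a + b < n`. -/
def meet {n : ℕ} (br : V [⋀^Fin n]→ₗ[K] K) :
    ExteriorAlgebra K V →ₗ[K] ExteriorAlgebra K V →ₗ[K] ExteriorAlgebra K V :=
  LinearMap.flip
    { toFun := fun B =>
        TensorProduct.lift (LinearMap.lsmul K (ExteriorAlgebra K V) ∘ₗ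
          (bracketForm br ∘ₗ LinearMap.mulRight K B)) ∘ₗ coproduct K V
      map_add' := fun B₁ B₂ => by
        refine LinearMap.ext fun A => ?_
        simp only [LinearMap.add_apply, LinearMap.comp_apply]
        induction coproduct K V A with
        | zero => simp
        | tmul x y => simp [mul_add]
        | add t u ht hu => rw [map_add, map_add, map_add, ht, hu]; abel
      map_smul' := fun c B => by
        refine LinearMap.ext fun A => ?_
        simp only [LinearMap.smul_apply, LinearMap.comp_apply, RingHom.id_apply]
        induction coproduct K V A with
        | zero => simp
        | tmul x y => simp [mul_smul]
        | add t u ht hu => rw [map_add, map_add, ht, hu, smul_add] }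

/-- The meet `X₀ ∧ X₁ ∧ ⋯ ∧ Xₘ` (nested from left to right), a multilinear map. -/
def iteratedMeet {n : ℕ} (br : V [⋀^Fin n]→ₗ[K] K) :
    (m : ℕ) → MultilinearMap K (fun _ : Fin (m + 1) => ExteriorAlgebra K V) (ExteriorAlgebra K V)
  | 0 => MultilinearMap.ofSubsingleton K _ _ (0 : Fin 1) LinearMap.id
  | m + 1 => ((meet br).compMultilinearMap (iteratedMeet br m)).uncurryRight

/-- The multilinear map `(X₀, …, Xₘ) ↦ (X₀ ∨ C₀) ∧ ⋯ ∧ (Xₘ ∨ Cₘ)`; the join `∨` is the product of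
the exterior algebra. -/
def meetOfJoins {n m : ℕ} (br : V [⋀^Fin n]→ₗ[K] K) (C : Fin (m + 1) → ExteriorAlgebra K V) :
    MultilinearMap K (fun _ : Fin (m + 1) => ExteriorAlgebra K V) (ExteriorAlgebra K V) :=
  (iteratedMeet br m).compLinearMap (fun h => LinearMap.mulRight K (C h))

/-- The tuples `(i₀, …, iₘ)` of non-negative integers with `i₀ + ⋯ + iₘ = s` and `i_h ≤ q_h`. -/
def boundedCompositions {m : ℕ} (q : Fin (m + 1) → ℕ) (s : ℕ) : Finset (Fin (m + 1) → ℕ) :=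
  (Finset.univ.piAntidiag s).filter (fun i => ∀ h, i h ≤ q h)

/-- The sign `ε` of the tuple `i`: `(-1)` to the power `∑_{h > k} i_h (q_k - i_k)`. -/
def altSign {m : ℕ} (q i : Fin (m + 1) → ℕ) : ℤˣ :=
  (-1) ^ (∑ h, ∑ k ∈ Finset.univ.filter (fun k => k < h), i h * (q k - i k))

end CayleyGrassmann

end

open scoped TensorProduct

noncomputable section

namespace CayleyGrassmann

variable {K : Type*} [Field K] {V : Type*} [AddCommGroup V] [Module K V]

/-! Both sides are meets of complementary steps, hence scalars: such a meet $X\wedge Y$ equals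
$[X\vee Y]\cdot 1$ (`meet_eq_bracketForm`). It remains to compare two brackets, $[A\vee
B\vee(C_1\wedge\cdots\wedge C_r)]$ and $[A\vee\Sigma]$, where $\Sigma$ is the signed sum.

The tool is $[x\vee(X\wedge Y)]=\sum_{(x)}[x_{(1)}\vee X][x_{(2)}\vee Y]$ (`bracketForm_mul_meet`),
which makes pairing with a meet dual to the coproduct. It rests on the two classical expansions of
the meet, $\sum[x_{(1)}\vee X]x_{(2)}=\sum[x\vee X_{(2)}]X_{(1)}$ (`dualMeet_eq_meet`).

The bracket identity (`bracketForm_mul_mul_iteratedMeet`) then follows by induction on $r$,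
splitting off $C_r$. Since $\Delta(A\vee B)=\Delta A\cdot\Delta B$ in the graded tensor square, the
bracket with $A\vee B$ breaks into products over slices of $A$ and $B$. Interchanging $A_{(2)}$ with
$B_{(1)}$ gives precisely the part of $\varepsilon$ that involves $i_r$. Throughout, homogeneous
elements replace extensors, everything being linear. -/

/-! ### Multiplicativity and homogeneity of the coproduct. -/

/-- The product of the graded tensor square, transported to the tensor square. -/
def gradedMul (K : Type*) [Field K] (V : Type*) [AddCommGroup V] [Module K V] :
    ExteriorAlgebra K V ⊗[K] ExteriorAlgebra K V →ₗ[K]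
      ExteriorAlgebra K V ⊗[K] ExteriorAlgebra K V →ₗ[K]
        ExteriorAlgebra K V ⊗[K] ExteriorAlgebra K V :=
  ((LinearMap.mul K (GradedSquare K V)).compl₁₂
    (GradedTensorProduct.of K (fun i : ℕ => ⋀[K]^i V) (fun i : ℕ => ⋀[K]^i V)).toLinearMap
    (GradedTensorProduct.of K (fun i : ℕ => ⋀[K]^i V) (fun i : ℕ => ⋀[K]^i V)).toLinearMap).compr₂
    (GradedTensorProduct.of K (fun i : ℕ => ⋀[K]^i V) (fun i : ℕ => ⋀[K]^i V)).symm.toLinearMap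

theorem gradedMul_tmul {b c : ℕ} (x : ExteriorAlgebra K V) {y z : ExteriorAlgebra K V}
    (w : ExteriorAlgebra K V) (hy : y ∈ ⋀[K]^b V) (hz : z ∈ ⋀[K]^c V) :
    gradedMul K V (x ⊗ₜ y) (z ⊗ₜ w) = (-1 : ℤˣ) ^ (b * c) • ((x * z) ⊗ₜ[K] (y * w)) :=
  GradedTensorProduct.tmul_coe_mul_coe_tmul (R := K) (fun i : ℕ => ⋀[K]^i V)
    (fun i : ℕ => ⋀[K]^i V) x ⟨y, hy⟩ ⟨z, hz⟩ w

theorem coproduct_mul (X Y : ExteriorAlgebra K V) :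
    coproduct K V (X * Y) = gradedMul K V (coproduct K V X) (coproduct K V Y) := by
  simp only [coproduct, LinearMap.comp_apply, AlgHom.toLinearMap_apply, map_mul]
  rfl

theorem ι_mem_exteriorPower_one (v : V) : ExteriorAlgebra.ι K v ∈ ⋀[K]^1 V := by
  simp

theorem one_mem_exteriorPower_zero : (1 : ExteriorAlgebra K V) ∈ ⋀[K]^0 V := by
  simp

theorem coproduct_ι (v : V) :
    coproduct K V (ExteriorAlgebra.ι K v) =
      ExteriorAlgebra.ι K v ⊗ₜ 1 + 1 ⊗ₜ ExteriorAlgebra.ι K v := by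
  simp only [coproduct, coproductHom, LinearMap.comp_apply, AlgHom.toLinearMap_apply,
    ExteriorAlgebra.lift_ι_apply]
  rfl

theorem coproduct_one : coproduct K V (1 : ExteriorAlgebra K V) = 1 ⊗ₜ 1 := by
  simp only [coproduct, LinearMap.comp_apply, AlgHom.toLinearMap_apply, map_one]
  rfl

theorem coproduct_algebraMap (r : K) :
    coproduct K V (algebraMap K _ r) = r • (1 ⊗ₜ 1) := by
  rw [Algebra.algebraMap_eq_smul_one, map_smul, coproduct_one]

/-- The span of the tensors `x ⊗ y` with `x`, `y` homogeneous of total step `j`. -/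
def homogeneousTensors (K : Type*) [Field K] (V : Type*) [AddCommGroup V] [Module K V] (j : ℕ) :
    Submodule K (ExteriorAlgebra K V ⊗[K] ExteriorAlgebra K V) :=
  Submodule.span K {t | ∃ a b, a + b = j ∧ ∃ x ∈ ⋀[K]^a V, ∃ y ∈ ⋀[K]^b V, t = x ⊗ₜ[K] y}

theorem gradedMul_coproduct_ι_left {a : ℕ} (v : V) {x y : ExteriorAlgebra K V}
    (hx : x ∈ ⋀[K]^a V) :
    gradedMul K V (coproduct K V (ExteriorAlgebra.ι K v)) (x ⊗ₜ[K] y) =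
      (ExteriorAlgebra.ι K v * x) ⊗ₜ y + (-1 : ℤˣ) ^ a • (x ⊗ₜ[K] (ExteriorAlgebra.ι K v * y)) := by
  rw [coproduct_ι, map_add, LinearMap.add_apply,
    gradedMul_tmul _ _ one_mem_exteriorPower_zero hx,
    gradedMul_tmul _ _ (ι_mem_exteriorPower_one v) hx]
  simp

theorem gradedMul_coproduct_ι_right {b : ℕ} (v : V) {x y : ExteriorAlgebra K V}
    (hy : y ∈ ⋀[K]^b V) :
    gradedMul K V (x ⊗ₜ[K] y) (coproduct K V (ExteriorAlgebra.ι K v)) =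
      (-1 : ℤˣ) ^ b • ((x * ExteriorAlgebra.ι K v) ⊗ₜ[K] y) +
        x ⊗ₜ[K] (y * ExteriorAlgebra.ι K v) := by
  rw [coproduct_ι, map_add,
    gradedMul_tmul _ _ hy one_mem_exteriorPower_zero,
    gradedMul_tmul _ _ hy (ι_mem_exteriorPower_one v)]
  simp

theorem coproduct_mem_homogeneousTensors {j : ℕ} {X : ExteriorAlgebra K V} (hX : X ∈ ⋀[K]^j V) :
    coproduct K V X ∈ homogeneousTensors K V j := by
  induction hX using Submodule.pow_induction_on_left' with
  | algebraMap r =>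
    rw [coproduct_algebraMap]
    exact Submodule.smul_mem _ _ (Submodule.subset_span
      ⟨0, 0, rfl, 1, one_mem_exteriorPower_zero, 1, one_mem_exteriorPower_zero, rfl⟩)
  | add x y i hx hy h₁ h₂ => rw [map_add]; exact add_mem h₁ h₂
  | mem_mul v hv i x hx ih =>
    obtain ⟨v, rfl⟩ := hv
    rw [coproduct_mul]
    refine Submodule.span_induction (p := fun t _ =>
      gradedMul K V (coproduct K V (ExteriorAlgebra.ι K v)) t ∈ homogeneousTensors K V i.succ)
      ?_ ?_ ?_ ?_ ih
    · rintro _ ⟨a, b, rfl, x, hx, y, hy, rfl⟩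
      rw [gradedMul_coproduct_ι_left v hx]
      refine add_mem ?_ ?_
      · refine Submodule.subset_span ⟨a + 1, b, by omega, _, ?_, _, hy, rfl⟩
        rw [add_comm a]
        exact SetLike.GradedMul.mul_mem (ι_mem_exteriorPower_one v) hx
      · rw [Units.smul_def]
        refine zsmul_mem ?_ _
        refine Submodule.subset_span ⟨a, b + 1, by omega, _, hx, _, ?_, rfl⟩
        rw [add_comm b]
        exact SetLike.GradedMul.mul_mem (ι_mem_exteriorPower_one v) hy
    · simp
    · intro x y _ _ h₁ h₂
      rw [map_add]; exact add_mem h₁ h₂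
    · intro c x _ h
      rw [map_smul]; exact Submodule.smul_mem _ _ h

theorem homogeneousTensors_induction {j : ℕ}
    {P : ExteriorAlgebra K V ⊗[K] ExteriorAlgebra K V → Prop} (zero : P 0)
    (tmul : ∀ a b, a + b = j → ∀ x ∈ ⋀[K]^a V, ∀ y ∈ ⋀[K]^b V, P (x ⊗ₜ y))
    (add : ∀ t u, P t → P u → P (t + u))
    {t : ExteriorAlgebra K V ⊗[K] ExteriorAlgebra K V} (ht : t ∈ homogeneousTensors K V j) :
    P t := by
  -- `P` is not assumed stable under scalars; quantifying over multiples lets them be absorbed into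
  -- the left tensor factor.
  suffices h : ∀ c : K, P (c • t) by simpa using h 1
  refine Submodule.span_induction (p := fun t _ => ∀ c : K, P (c • t)) ?_ ?_ ?_ ?_ ht
  · rintro _ ⟨a, b, hab, x, hx, y, hy, rfl⟩ c
    rw [TensorProduct.smul_tmul']
    exact tmul a b hab _ (Submodule.smul_mem _ _ hx) _ hy
  · simpa using zero
  · intro x y _ _ h₁ h₂ c
    rw [smul_add]; exact add _ _ (h₁ c) (h₂ c)
  · intro d x _ h c
    rw [smul_smul]; exact h _

theorem exteriorAlgebra_induction {P : ExteriorAlgebra K V → Prop}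
    (homogeneous : ∀ j, ∀ x ∈ ⋀[K]^j V, P x) (add : ∀ x y, P x → P y → P (x + y))
    (X : ExteriorAlgebra K V) : P X :=
  DirectSum.Decomposition.inductionOn (fun i : ℕ => ⋀[K]^i V)
    (homogeneous 0 0 (zero_mem _)) (fun m => homogeneous _ m m.2) add X

theorem tensor_induction {P : ExteriorAlgebra K V ⊗[K] ExteriorAlgebra K V → Prop}
    (zero : P 0)
    (tmul : ∀ a b, ∀ x ∈ ⋀[K]^a V, ∀ y ∈ ⋀[K]^b V, P (x ⊗ₜ y))
    (add : ∀ t u, P t → P u → P (t + u))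
    (t : ExteriorAlgebra K V ⊗[K] ExteriorAlgebra K V) : P t := by
  induction t with
  | zero => exact zero
  | add t u h₁ h₂ => exact add _ _ h₁ h₂
  | tmul x y =>
    refine exteriorAlgebra_induction (P := fun x => P (x ⊗ₜ y)) (fun a x hx => ?_)
      (fun x x' h₁ h₂ => by rw [TensorProduct.add_tmul]; exact add _ _ h₁ h₂) x
    refine exteriorAlgebra_induction (P := fun y => P (x ⊗ₜ y)) (fun b y hy => ?_)
      (fun y y' h₁ h₂ => by rw [TensorProduct.tmul_add]; exact add _ _ h₁ h₂) y
    exact tmul a b x hx y hy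

/-! ### Grade involution, and the coproduct of a product with a vector. -/

/-- The grade involution, as a linear map. -/
def gradeInvolution (K : Type*) [Field K] (V : Type*) [AddCommGroup V] [Module K V] :
    ExteriorAlgebra K V →ₗ[K] ExteriorAlgebra K V :=
  (CliffordAlgebra.involute (Q := (0 : QuadraticForm K V))).toLinearMap

theorem gradeInvolution_mul (x y : ExteriorAlgebra K V) :
    gradeInvolution K V (x * y) = gradeInvolution K V x * gradeInvolution K V y :=
  map_mul CliffordAlgebra.involute x y

theorem gradeInvolution_ι (v : V) :
    gradeInvolution K V (ExteriorAlgebra.ι K v) = - ExteriorAlgebra.ι K v :=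
  CliffordAlgebra.involute_ι v

theorem gradeInvolution_gradeInvolution (x : ExteriorAlgebra K V) :
    gradeInvolution K V (gradeInvolution K V x) = x :=
  CliffordAlgebra.involute_involute x

theorem gradeInvolution_of_mem {j : ℕ} {X : ExteriorAlgebra K V} (hX : X ∈ ⋀[K]^j V) :
    gradeInvolution K V X = (-1 : ℤˣ) ^ j • X := by
  induction hX using Submodule.pow_induction_on_left' with
  | algebraMap r =>
    rw [pow_zero, one_smul]
    exact AlgHom.commutes CliffordAlgebra.involute r
  | add x y i hx hy h₁ h₂ => rw [map_add, h₁, h₂, smul_add]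
  | mem_mul v hv i x hx ih =>
    obtain ⟨v, rfl⟩ := hv
    rw [gradeInvolution_mul, gradeInvolution_ι, ih, pow_succ, mul_smul, Units.smul_def, Units.smul_def,
      Units.smul_def, mul_smul_comm, neg_mul]
    simp

theorem ι_mul_eq_gradeInvolution_mul (v : V) (x : ExteriorAlgebra K V) :
    ExteriorAlgebra.ι K v * x = gradeInvolution K V x * ExteriorAlgebra.ι K v := by
  refine CliffordAlgebra.left_induction (Q := (0 : QuadraticForm K V))
    (P := fun x => ExteriorAlgebra.ι K v * x = gradeInvolution K V x * ExteriorAlgebra.ι K v)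
    ?_ ?_ ?_ x
  · intro r
    rw [show gradeInvolution K V (algebraMap K _ r) = algebraMap K _ r from
      AlgHom.commutes CliffordAlgebra.involute r]
    exact (Algebra.commutes _ _).symm
  · intro x y hx hy
    rw [mul_add, map_add, add_mul, hx, hy]
  · intro x w hx
    change ExteriorAlgebra.ι K v * (ExteriorAlgebra.ι K w * x) =
      gradeInvolution K V (ExteriorAlgebra.ι K w * x) * _
    rw [gradeInvolution_mul, gradeInvolution_ι, mul_assoc, ← hx, ← mul_assoc, ← mul_assoc,
      eq_neg_of_add_eq_zero_left (ExteriorAlgebra.ι_add_mul_swap v w), neg_mul, neg_mul, neg_mul]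

/-- The sign from moving $v$ past the left factor is the grade involution of that factor, so the
formula is linear and needs no homogeneity. -/
theorem coproduct_ι_mul (v : V) (X : ExteriorAlgebra K V) :
    coproduct K V (ExteriorAlgebra.ι K v * X) =
      (LinearMap.mulLeft K (ExteriorAlgebra.ι K v)).rTensor _ (coproduct K V X) +
        TensorProduct.map (gradeInvolution K V) (LinearMap.mulLeft K (ExteriorAlgebra.ι K v))
          (coproduct K V X) := by
  rw [coproduct_mul]
  induction coproduct K V X using tensor_induction with
  | zero => simp
  | tmul a b x hx y hy =>
    rw [gradedMul_coproduct_ι_left v hx, LinearMap.rTensor_tmul, TensorProduct.map_tmul,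
      gradeInvolution_of_mem hx]
    rfl
  | add t u h₁ h₂ => simp only [map_add, h₁, h₂]; abel

theorem coproduct_mul_ι (v : V) (X : ExteriorAlgebra K V) :
    coproduct K V (X * ExteriorAlgebra.ι K v) =
      TensorProduct.map (LinearMap.mulRight K (ExteriorAlgebra.ι K v)) (gradeInvolution K V)
          (coproduct K V X) +
        (LinearMap.mulRight K (ExteriorAlgebra.ι K v)).lTensor _ (coproduct K V X) := by
  rw [coproduct_mul]
  induction coproduct K V X using tensor_induction with
  | zero => simp
  | tmul a b x hx y hy =>
    rw [gradedMul_coproduct_ι_right v hy, LinearMap.lTensor_tmul, TensorProduct.map_tmul,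
      gradeInvolution_of_mem hy, Units.smul_def, Units.smul_def, TensorProduct.tmul_smul]
    rfl
  | add t u h₁ h₂ => simp only [map_add, LinearMap.add_apply, h₁, h₂]; abel

/-! ### Counit laws. -/

/-- The augmentation `Λ(V) → K`. -/
def counit (K : Type*) [Field K] (V : Type*) [AddCommGroup V] [Module K V] :
    ExteriorAlgebra K V →ₗ[K] K :=
  (ExteriorAlgebra.algebraMapInv (R := K) (M := V)).toLinearMap

theorem counit_mul (x y : ExteriorAlgebra K V) : counit K V (x * y) = counit K V x * counit K V y :=
  map_mul ExteriorAlgebra.algebraMapInv x y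

theorem counit_ι (v : V) : counit K V (ExteriorAlgebra.ι K v) = 0 := by
  simp [counit, ExteriorAlgebra.algebraMapInv]

theorem counit_algebraMap (r : K) : counit K V (algebraMap K _ r) = r :=
  ExteriorAlgebra.algebraMap_leftInverse V r

theorem counit_gradeInvolution (x : ExteriorAlgebra K V) :
    counit K V (gradeInvolution K V x) = counit K V x := by
  refine CliffordAlgebra.left_induction (Q := (0 : QuadraticForm K V))
    (P := fun x => counit K V (gradeInvolution K V x) = counit K V x) ?_ ?_ ?_ x
  · intro r
    rw [show gradeInvolution K V (algebraMap K _ r) = algebraMap K _ r from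
      AlgHom.commutes CliffordAlgebra.involute r]
  · intro x y hx hy
    rw [map_add, map_add, map_add, hx, hy]
  · intro x w _
    change counit K V (gradeInvolution K V (ExteriorAlgebra.ι K w * x)) =
      counit K V (ExteriorAlgebra.ι K w * x)
    rw [gradeInvolution_mul, gradeInvolution_ι, neg_mul, map_neg, counit_mul, counit_mul,
      counit_ι, zero_mul, zero_mul, neg_zero]

theorem eq_algebraMap_counit {X : ExteriorAlgebra K V} (hX : X ∈ ⋀[K]^0 V) :
    X = counit K V X • 1 := by
  change X ∈ LinearMap.range (ExteriorAlgebra.ι K) ^ 0 at hX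
  rw [pow_zero, Submodule.mem_one] at hX
  obtain ⟨r, rfl⟩ := hX
  rw [counit_algebraMap, Algebra.algebraMap_eq_smul_one]

theorem counit_left (X : ExteriorAlgebra K V) :
    TensorProduct.lid K _ ((counit K V).rTensor _ (coproduct K V X)) = X := by
  refine CliffordAlgebra.left_induction (Q := (0 : QuadraticForm K V))
    (P := fun X => TensorProduct.lid K _ ((counit K V).rTensor _ (coproduct K V X)) = X) ?_ ?_ ?_ X
  · intro r
    change TensorProduct.lid K _
      ((counit K V).rTensor _ (coproduct K V (algebraMap K (ExteriorAlgebra K V) r))) = _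
    rw [coproduct_algebraMap, map_smul, map_smul, LinearMap.rTensor_tmul, TensorProduct.lid_tmul,
      ← map_one (algebraMap K (ExteriorAlgebra K V)), counit_algebraMap, map_one, one_smul,
      ← Algebra.algebraMap_eq_smul_one]
  · intro x y hx hy
    rw [map_add, map_add, map_add, hx, hy]
  · intro x v hx
    change TensorProduct.lid K _
      ((counit K V).rTensor _ (coproduct K V (ExteriorAlgebra.ι K v * x))) =
        ExteriorAlgebra.ι K v * x
    rw [coproduct_ι_mul]
    conv_rhs => rw [← hx]
    induction coproduct K V x with
    | zero => simp
    | tmul x y => simp [counit_mul, counit_ι, counit_gradeInvolution]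
    | add t u h₁ h₂ =>
      simp only [map_add, mul_add, ← h₁, ← h₂]; abel

theorem counit_right (X : ExteriorAlgebra K V) :
    TensorProduct.rid K _ ((counit K V).lTensor _ (coproduct K V X)) = X := by
  refine CliffordAlgebra.right_induction (Q := (0 : QuadraticForm K V))
    (P := fun X => TensorProduct.rid K _ ((counit K V).lTensor _ (coproduct K V X)) = X) ?_ ?_ ?_ X
  · intro r
    change TensorProduct.rid K _
      ((counit K V).lTensor _ (coproduct K V (algebraMap K (ExteriorAlgebra K V) r))) = _
    rw [coproduct_algebraMap, map_smul, map_smul, LinearMap.lTensor_tmul, TensorProduct.rid_tmul,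
      ← map_one (algebraMap K (ExteriorAlgebra K V)), counit_algebraMap, map_one, one_smul,
      ← Algebra.algebraMap_eq_smul_one]
  · intro x y hx hy
    rw [map_add, map_add, map_add, hx, hy]
  · intro v x hx
    change TensorProduct.rid K _
      ((counit K V).lTensor _ (coproduct K V (x * ExteriorAlgebra.ι K v))) =
        x * ExteriorAlgebra.ι K v
    rw [coproduct_mul_ι]
    conv_rhs => rw [← hx]
    induction coproduct K V x with
    | zero => simp
    | tmul x y => simp [counit_mul, counit_ι, counit_gradeInvolution]
    | add t u h₁ h₂ =>
      simp only [map_add, add_mul, ← h₁, ← h₂]; abel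

/-! ### The bracket and the two expansions of the meet. -/

theorem bracketForm_of_mem {n j : ℕ} (br : V [⋀^Fin n]→ₗ[K] K) (hj : j ≠ n)
    {X : ExteriorAlgebra K V} (hX : X ∈ ⋀[K]^j V) : bracketForm br X = 0 := by
  rw [← ExteriorAlgebra.ιMulti_span_fixedDegree] at hX
  induction hX using Submodule.span_induction with
  | mem x h =>
    obtain ⟨v, rfl⟩ := h
    rw [bracketForm, ExteriorAlgebra.liftAlternating_apply_ιMulti, Pi.single_eq_of_ne hj]
    rfl
  | zero => simp
  | add x y _ _ h₁ h₂ => rw [map_add, h₁, h₂, add_zero]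
  | smul c x _ h => rw [map_smul, h, smul_zero]

theorem eq_zero_of_mem_of_finrank_lt [FiniteDimensional K V] {j : ℕ}
    (hj : Module.finrank K V < j) {X : ExteriorAlgebra K V} (hX : X ∈ ⋀[K]^j V) : X = 0 := by
  rw [← ExteriorAlgebra.ιMulti_span_fixedDegree] at hX
  induction hX using Submodule.span_induction with
  | mem x h =>
    obtain ⟨v, rfl⟩ := h
    refine AlternatingMap.map_linearDependent _ _ fun h => ?_
    have := h.fintype_card_le_finrank
    rw [Fintype.card_fin] at this
    omega
  | zero => rfl
  | add x y _ _ h₁ h₂ => rw [h₁, h₂, add_zero]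
  | smul c x _ h => rw [h, smul_zero]

theorem meet_eq {n : ℕ} (br : V [⋀^Fin n]→ₗ[K] K) (X Y : ExteriorAlgebra K V) :
    meet br X Y = TensorProduct.lid K _
      ((bracketForm br ∘ₗ LinearMap.mulRight K Y).rTensor _ (coproduct K V X)) := by
  change TensorProduct.lift (LinearMap.lsmul K (ExteriorAlgebra K V) ∘ₗ
    (bracketForm br ∘ₗ LinearMap.mulRight K Y)) (coproduct K V X) = _
  induction coproduct K V X with
  | zero => simp
  | tmul x y => simp
  | add t u h₁ h₂ => simp only [map_add, h₁, h₂]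

/-- `∑ [x X₍₂₎] X₍₁₎`, the expression of the meet `x ∧ X` in terms of the slices of `X`. -/
def dualMeet {n : ℕ} (br : V [⋀^Fin n]→ₗ[K] K) (x X : ExteriorAlgebra K V) :
    ExteriorAlgebra K V :=
  TensorProduct.rid K _
    ((bracketForm br ∘ₗ LinearMap.mulLeft K x).lTensor _ (coproduct K V X))

/-- Of the two terms of $\Delta(vX)$, one puts $v$ outside the bracket and the other moves it
inside, next to $x$. Read backwards, this is a recursion for `dualMeet` on its first argument,
matching `meet_mul_ι`. -/
theorem dualMeet_ι_mul {n : ℕ} (br : V [⋀^Fin n]→ₗ[K] K) (x X : ExteriorAlgebra K V) (v : V) :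
    dualMeet br x (ExteriorAlgebra.ι K v * X) =
      ExteriorAlgebra.ι K v * dualMeet br x X +
        gradeInvolution K V (dualMeet br (x * ExteriorAlgebra.ι K v) X) := by
  simp only [dualMeet, coproduct_ι_mul]
  induction coproduct K V X with
  | zero => simp
  | tmul x y => simp
  | add t u h₁ h₂ =>
    simp only [map_add, mul_add] at h₁ h₂ ⊢
    rw [add_add_add_comm, h₁, h₂]; abel

theorem meet_mul_ι {n : ℕ} (br : V [⋀^Fin n]→ₗ[K] K) (x X : ExteriorAlgebra K V) (v : V) :
    meet br (x * ExteriorAlgebra.ι K v) X =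
      gradeInvolution K V (meet br x (ExteriorAlgebra.ι K v * X)) +
        meet br x X * ExteriorAlgebra.ι K v := by
  simp only [meet_eq, coproduct_mul_ι]
  induction coproduct K V x with
  | zero => simp
  | tmul x y => simp [mul_assoc]
  | add t u h₁ h₂ =>
    simp only [map_add, add_mul] at h₁ h₂ ⊢
    rw [add_add_add_comm, h₁, h₂]; abel

theorem dualMeet_one [FiniteDimensional K V] {n : ℕ} (hn : Module.finrank K V = n)
    (br : V [⋀^Fin n]→ₗ[K] K) (X : ExteriorAlgebra K V) :
    dualMeet br 1 X = bracketForm br X • 1 := by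
  induction X using exteriorAlgebra_induction with
  | add x y h₁ h₂ =>
    rw [map_add, add_smul, ← h₁, ← h₂]
    simp only [dualMeet, map_add]
  | homogeneous j X hX =>
    rcases lt_or_ge n j with hj | hj
    -- Here $\dim V=n$ matters: an $X$ of step above $n$ could otherwise have slices with $X_{(2)}$
    -- of step $n$ and $X_{(1)}$ of positive step.
    · rw [eq_zero_of_mem_of_finrank_lt (hn ▸ hj) hX]
      simp [dualMeet]
    conv_rhs => rw [← counit_left X]
    rw [dualMeet]
    refine homogeneousTensors_induction (P := fun t =>
      TensorProduct.rid K _ ((bracketForm br ∘ₗ LinearMap.mulLeft K 1).lTensor _ t) =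
        bracketForm br (TensorProduct.lid K _ ((counit K V).rTensor _ t)) • 1)
      (by simp) (fun a b hab x hx y hy => ?_)
      (fun t u h₁ h₂ => by simp only [map_add, add_smul, h₁, h₂])
      (coproduct_mem_homogeneousTensors hX)
    · simp only [LinearMap.lTensor_tmul, LinearMap.rTensor_tmul, TensorProduct.rid_tmul,
        TensorProduct.lid_tmul, LinearMap.comp_apply, LinearMap.mulLeft_apply, one_mul, map_smul]
      rcases eq_or_ne a 0 with rfl | ha
      · conv_lhs => rw [eq_algebraMap_counit hx]
        rw [smul_smul, smul_eq_mul, mul_comm]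
      · rw [bracketForm_of_mem br (by omega) hy]
        simp

theorem meet_one_left {n : ℕ} (br : V [⋀^Fin n]→ₗ[K] K) (X : ExteriorAlgebra K V) :
    meet br 1 X = bracketForm br X • 1 := by
  simp [meet_eq, coproduct_one]

/-- The two expressions of the meet agree. -/
theorem dualMeet_eq_meet [FiniteDimensional K V] {n : ℕ} (hn : Module.finrank K V = n)
    (br : V [⋀^Fin n]→ₗ[K] K) (x X : ExteriorAlgebra K V) :
    dualMeet br x X = meet br x X := by
  revert X
  refine CliffordAlgebra.right_induction (Q := (0 : QuadraticForm K V))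
    (P := fun x => ∀ X : ExteriorAlgebra K V, dualMeet br x X = meet br x X) ?_ ?_ ?_ x
  · intro r X
    change dualMeet br (algebraMap K (ExteriorAlgebra K V) r) X =
      meet br (algebraMap K (ExteriorAlgebra K V) r) X
    rw [Algebra.algebraMap_eq_smul_one, map_smul, LinearMap.smul_apply, meet_one_left,
      ← dualMeet_one hn]
    simp only [dualMeet]
    induction coproduct K V X with
    | zero => simp
    | tmul x y => simp [mul_smul]
    | add t u h₁ h₂ => simp only [map_add, h₁, h₂, smul_add]
  · intro x y hx hy X
    rw [map_add, LinearMap.add_apply, ← hx, ← hy]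
    simp only [dualMeet]
    induction coproduct K V X with
    | zero => simp
    | tmul x y => simp [add_mul, add_smul]
    | add t u h₁ h₂ =>
      simp only [map_add, h₁, h₂]; abel
  · intro v x hx X
    change dualMeet br (x * ExteriorAlgebra.ι K v) X = meet br (x * ExteriorAlgebra.ι K v) X
    have h := dualMeet_ι_mul br x X v
    -- Applying the involution to `h` isolates `dualMeet` at $xv$; since $v\hat d=dv$, the remaining
    -- term becomes the one in `meet_mul_ι`.
    rw [meet_mul_ι, ← hx, ← hx, h, map_add, gradeInvolution_gradeInvolution,
      gradeInvolution_mul, gradeInvolution_ι, neg_mul, ι_mul_eq_gradeInvolution_mul,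
      gradeInvolution_gradeInvolution]
    abel

/-- Expanding $X\wedge Y$ over $\Delta X$ gives $\sum[X_{(1)}Y][xX_{(2)}]$, which is the bracket of
`dualMeet br x X` with $Y$. Replacing `dualMeet` by the meet trades $\Delta X$ for $\Delta x$. -/
theorem bracketForm_mul_meet [FiniteDimensional K V] {n : ℕ} (hn : Module.finrank K V = n)
    (br : V [⋀^Fin n]→ₗ[K] K) (x X Y : ExteriorAlgebra K V) :
    bracketForm br (x * meet br X Y) =
      LinearMap.mul' K K (TensorProduct.map (bracketForm br ∘ₗ LinearMap.mulRight K X)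
        (bracketForm br ∘ₗ LinearMap.mulRight K Y) (coproduct K V x)) := by
  have h : bracketForm br (x * meet br X Y) = bracketForm br (dualMeet br x X * Y) := by
    rw [meet_eq, dualMeet]
    induction coproduct K V X with
    | zero => simp
    | tmul x y => simp [mul_comm]
    | add t u h₁ h₂ => simp only [map_add, mul_add, add_mul, h₁, h₂]
  rw [h, dualMeet_eq_meet hn, meet_eq]
  induction coproduct K V x with
  | zero => simp
  | tmul x y => simp
  | add t u h₁ h₂ => simp only [map_add, add_mul, h₁, h₂]

/-- A meet of complementary steps is a bracket. -/
theorem meet_eq_bracketForm {n p : ℕ} (br : V [⋀^Fin n]→ₗ[K] K) {X Y : ExteriorAlgebra K V}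
    (hX : X ∈ ⋀[K]^p V)
    (hY : ∀ a, a ≠ p → ∀ x ∈ ⋀[K]^a V, bracketForm br (x * Y) = 0) :
    meet br X Y = bracketForm br (X * Y) • 1 := by
  -- The counit law puts both sides over $\Delta X$. Then `hY`, which stands in for "$Y$ has step
  -- $n-p$", kills every slice whose second factor is not a scalar.
  conv_rhs => rw [← counit_right X]
  rw [meet_eq]
  refine homogeneousTensors_induction (P := fun t =>
    TensorProduct.lid K _ ((bracketForm br ∘ₗ LinearMap.mulRight K Y).rTensor _ t) =
      bracketForm br (TensorProduct.rid K _ ((counit K V).lTensor _ t) * Y) • 1)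
    (by simp) (fun a b hab x hx y hy => ?_)
    (fun t u h₁ h₂ => by simp only [map_add, add_mul, add_smul, h₁, h₂])
    (coproduct_mem_homogeneousTensors hX)
  · simp only [LinearMap.lTensor_tmul, LinearMap.rTensor_tmul, TensorProduct.rid_tmul,
      TensorProduct.lid_tmul, LinearMap.comp_apply, LinearMap.mulRight_apply, smul_mul_assoc,
      map_smul]
    rcases eq_or_ne b 0 with rfl | hb
    · conv_lhs => rw [eq_algebraMap_counit hy]
      rw [smul_smul, smul_eq_mul, mul_comm]
    · rw [hY a (by omega) x hx]
      simp

/-! ### Homogeneous components and the recursion for Sweedler sums. -/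

theorem IsExtensor.mem {j : ℕ} {A : ExteriorAlgebra K V} (hA : IsExtensor j A) : A ∈ ⋀[K]^j V := by
  obtain ⟨c, v, rfl⟩ := hA
  rw [← ExteriorAlgebra.ιMulti_span_fixedDegree]
  exact Submodule.smul_mem _ _ (Submodule.subset_span ⟨v, rfl⟩)

theorem proj_of_mem {j : ℕ} {X : ExteriorAlgebra K V} (hX : X ∈ ⋀[K]^j V) :
    GradedAlgebra.proj (fun i : ℕ => ⋀[K]^i V) j X = X := by
  rw [GradedAlgebra.proj_apply]
  exact DirectSum.decompose_of_mem_same (fun i : ℕ => ⋀[K]^i V) hX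

theorem proj_of_mem_ne {i j : ℕ} (hij : i ≠ j) {X : ExteriorAlgebra K V} (hX : X ∈ ⋀[K]^i V) :
    GradedAlgebra.proj (fun i : ℕ => ⋀[K]^i V) j X = 0 := by
  rw [GradedAlgebra.proj_apply]
  exact DirectSum.decompose_of_mem_ne (fun i : ℕ => ⋀[K]^i V) hX hij

theorem proj_mem (j : ℕ) (X : ExteriorAlgebra K V) :
    GradedAlgebra.proj (fun i : ℕ => ⋀[K]^i V) j X ∈ ⋀[K]^j V := by
  rw [GradedAlgebra.proj_apply]
  exact SetLike.coe_mem _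

/-- The Sweedler sum as a linear map. -/
def sweedlerMap {m : ℕ} (j : Fin (m + 1) → ℕ)
    (Φ : MultilinearMap K (fun _ : Fin (m + 1) => ExteriorAlgebra K V) (ExteriorAlgebra K V)) :
    ExteriorAlgebra K V →ₗ[K] ExteriorAlgebra K V :=
  PiTensorProduct.lift Φ ∘ₗ
    PiTensorProduct.map (fun h => GradedAlgebra.proj (fun i : ℕ => ⋀[K]^i V) (j h)) ∘ₗ
      iteratedCoproduct K V m

theorem sweedlerMap_zero {n : ℕ} (br : V [⋀^Fin n]→ₗ[K] K) (j : Fin 1 → ℕ)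
    (C : Fin 1 → ExteriorAlgebra K V) (B : ExteriorAlgebra K V) :
    sweedlerMap (m := 0) j (meetOfJoins br C) B =
      GradedAlgebra.proj (fun i : ℕ => ⋀[K]^i V) (j 0) B * C 0 := by
  have h : iteratedCoproduct K V 0 B = PiTensorProduct.tprod K (fun _ => B) := by
    rw [iteratedCoproduct, LinearEquiv.coe_coe, LinearEquiv.symm_apply_eq]
    simp
  rw [sweedlerMap, LinearMap.comp_apply, LinearMap.comp_apply, h, PiTensorProduct.map_tprod,
    PiTensorProduct.lift.tprod]
  rfl

theorem iteratedMeet_succ {n m : ℕ} (br : V [⋀^Fin n]→ₗ[K] K)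
    (C : Fin (m + 2) → ExteriorAlgebra K V) :
    iteratedMeet br (m + 1) C = meet br (iteratedMeet br m (Fin.init C)) (C (Fin.last (m + 1))) :=
  rfl

theorem iteratedCoproduct_succ (m : ℕ) (B : ExteriorAlgebra K V) :
    iteratedCoproduct K V (m + 1) B =
      TensorPower.mulEquiv (n := m + 1) (m := 1)
        (TensorProduct.map (iteratedCoproduct K V m)
          (PiTensorProduct.subsingletonEquiv (R := K)
            (s := fun _ : Fin 1 => ExteriorAlgebra K V) 0).symm.toLinearMap
          (coproduct K V B)) :=
  rfl

/-- Both the iterated coproduct and the iterated meet are nested from the left, so the last factor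
of each splits off simultaneously. -/
theorem sweedlerMap_succ {n m : ℕ} (br : V [⋀^Fin n]→ₗ[K] K) (j : Fin (m + 2) → ℕ)
    (C : Fin (m + 2) → ExteriorAlgebra K V) :
    sweedlerMap j (meetOfJoins br C) =
      TensorProduct.lift ((meet br).compl₁₂ (sweedlerMap (Fin.init j) (meetOfJoins br (Fin.init C)))
        (LinearMap.mulRight K (C (Fin.last (m + 1))) ∘ₗ
          GradedAlgebra.proj (fun i : ℕ => ⋀[K]^i V) (j (Fin.last (m + 1))))) ∘ₗ
        coproduct K V := by
  refine LinearMap.ext fun B => ?_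
  rw [sweedlerMap, LinearMap.comp_apply, LinearMap.comp_apply, LinearMap.comp_apply,
    iteratedCoproduct_succ]
  induction coproduct K V B with
  | zero => simp
  | add t u h₁ h₂ => simp only [map_add, h₁, h₂]
  | tmul x y =>
    have hy : (PiTensorProduct.subsingletonEquiv (R := K)
        (s := fun _ : Fin 1 => ExteriorAlgebra K V) 0).symm y =
          PiTensorProduct.tprod K (fun _ => y) := by
      rw [LinearEquiv.symm_apply_eq]; simp
    rw [TensorProduct.map_tmul, LinearEquiv.coe_coe, hy, TensorProduct.lift.tmul,
      LinearMap.compl₁₂_apply, sweedlerMap, LinearMap.comp_apply, LinearMap.comp_apply]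
    induction iteratedCoproduct K V m x using PiTensorProduct.induction_on with
    | add t u h₁ h₂ =>
      simp only [TensorProduct.add_tmul, map_add, LinearMap.add_apply, h₁, h₂]
    | smul_tprod r a =>
      rw [← TensorProduct.smul_tmul']
      simp only [map_smul, LinearMap.smul_apply]
      congr 1
      rw [← TensorPower.gMul_def, TensorPower.tprod_mul_tprod, PiTensorProduct.map_tprod,
        PiTensorProduct.lift.tprod, PiTensorProduct.map_tprod, PiTensorProduct.lift.tprod,
        meetOfJoins, meetOfJoins, MultilinearMap.compLinearMap_apply, iteratedMeet_succ]
      refine congrArg₂ (fun X Y => meet br X Y) ?_ ?_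
      · rw [MultilinearMap.compLinearMap_apply]
        congr 1
        funext h
        have : Fin.append a (fun _ : Fin 1 => y) h.castSucc = a h := Fin.append_left a _ h
        simp only [Fin.init, this]
      · have : Fin.append a (fun _ : Fin 1 => y) (Fin.last (m + 1)) = y :=
          Fin.append_right a (fun _ : Fin 1 => y) 0
        simp only [this, LinearMap.comp_apply]

/-! ### Bounded compositions, signs, and the recursion for the signed sum. -/

theorem mem_boundedCompositions {m : ℕ} {q i : Fin (m + 1) → ℕ} {s : ℕ} :
    i ∈ boundedCompositions q s ↔ ∑ h, i h = s ∧ ∀ h, i h ≤ q h := by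
  simp [boundedCompositions, Finset.mem_piAntidiag]

theorem sum_boundedCompositions_succ {m : ℕ} {M : Type*} [AddCommMonoid M] (q : Fin (m + 2) → ℕ)
    (s : ℕ) (F : (Fin (m + 2) → ℕ) → M) :
    ∑ i ∈ boundedCompositions q s, F i =
      ∑ e ∈ (Finset.HasAntidiagonal.antidiagonal s).filter (fun e => e.2 ≤ q (Fin.last (m + 1))),
        ∑ i ∈ boundedCompositions (Fin.init q) e.1,
          F (Fin.snoc (α := fun _ => ℕ) i e.2) := by
  rw [Finset.sum_sigma']
  refine Finset.sum_bij' (fun i _ => ⟨(∑ h, Fin.init i h, i (Fin.last (m + 1))), Fin.init i⟩)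
    (fun e _ => Fin.snoc (α := fun _ => ℕ) e.2 e.1.2) ?_ ?_ ?_ ?_ ?_
  · intro i hi
    obtain ⟨h₁, h₂⟩ := mem_boundedCompositions.1 hi
    rw [Fin.sum_univ_castSucc] at h₁
    simp only [Finset.mem_sigma, Finset.mem_filter, Finset.HasAntidiagonal.mem_antidiagonal,
      mem_boundedCompositions]
    exact ⟨⟨h₁, h₂ _⟩, trivial, fun h => h₂ _⟩
  · rintro ⟨⟨a, j⟩, i⟩ he
    simp only [Finset.mem_sigma, Finset.mem_filter, Finset.HasAntidiagonal.mem_antidiagonal,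
      mem_boundedCompositions] at he
    obtain ⟨⟨h₁, h₂⟩, h₃, h₄⟩ := he
    rw [mem_boundedCompositions, Fin.sum_univ_castSucc]
    refine ⟨by simp [h₃, h₁], fun h => ?_⟩
    refine Fin.lastCases ?_ (fun h => ?_) h
    · simpa using h₂
    · simpa [Fin.init] using h₄ h
  · intro i _
    exact Fin.snoc_init_self i
  · rintro ⟨⟨a, j⟩, i⟩ he
    simp only [Finset.mem_sigma, mem_boundedCompositions] at he
    obtain ⟨-, rfl, -⟩ := he
    simp
  · intro i _
    rw [Fin.snoc_init_self]

/-- The last index is greater than all others and less than none, so it contributes only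
$j\sum_l(q_l-i_l)$ to the exponent. This depends on `i` through its sum alone, hence factors out of
the inner sum in `alternatingSumMap_succ`. -/
theorem altSign_snoc {m : ℕ} (q : Fin (m + 2) → ℕ) {i : Fin (m + 1) → ℕ} {a : ℕ} (j : ℕ)
    (hi : i ∈ boundedCompositions (Fin.init q) a) :
    altSign q (Fin.snoc (α := fun _ => ℕ) i j) =
      (-1) ^ (j * (∑ h, Fin.init q h - a)) * altSign (Fin.init q) i := by
  obtain ⟨rfl, h⟩ := mem_boundedCompositions.1 hi
  rw [altSign, altSign, Fin.sum_univ_castSucc, pow_add, mul_comm]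
  congr 2
  -- Truncated subtraction commutes with the sum because $i_h\le q_h$ for every $h$.
  · rw [Finset.sum_filter, Fin.sum_univ_castSucc, ← Finset.sum_tsub_distrib _ (fun x _ => h x), Finset.mul_sum]
    simp [Fin.castSucc_lt_last, Fin.init]
  · refine Finset.sum_congr rfl fun x _ => ?_
    rw [Finset.sum_filter, Finset.sum_filter, Fin.sum_univ_castSucc]
    simp [Fin.castSucc_lt_castSucc_iff, Fin.init, (Fin.castSucc_lt_last x).not_gt]

/-- The signed sum `∑ ε ∑_(B) (B₍₁₎ ∨ C₁) ∧ ⋯ ∧ (B₍ᵣ₎ ∨ Cᵣ)`, as a linear map in `B`. -/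
def alternatingSumMap {n m : ℕ} (br : V [⋀^Fin n]→ₗ[K] K) (q : Fin (m + 1) → ℕ)
    (C : Fin (m + 1) → ExteriorAlgebra K V) (s : ℕ) :
    ExteriorAlgebra K V →ₗ[K] ExteriorAlgebra K V :=
  ∑ i ∈ boundedCompositions q s,
    (altSign q i : ℤ) • sweedlerMap (fun h => q h - i h) (meetOfJoins br C)

theorem alternatingSumMap_apply {n m : ℕ} (br : V [⋀^Fin n]→ₗ[K] K) (q : Fin (m + 1) → ℕ)
    (C : Fin (m + 1) → ExteriorAlgebra K V) (s : ℕ) (B : ExteriorAlgebra K V) :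
    alternatingSumMap br q C s B =
      ∑ i ∈ boundedCompositions q s,
        altSign q i • sweedlerMap (fun h => q h - i h) (meetOfJoins br C) B := by
  simp [alternatingSumMap, LinearMap.sum_apply, Units.smul_def]

theorem alternatingSumMap_succ {n m : ℕ} (br : V [⋀^Fin n]→ₗ[K] K) (q : Fin (m + 2) → ℕ)
    (C : Fin (m + 2) → ExteriorAlgebra K V) (s : ℕ) :
    alternatingSumMap br q C s =
      ∑ e ∈ (Finset.HasAntidiagonal.antidiagonal s).filter (fun e => e.2 ≤ q (Fin.last (m + 1))),
        (-1 : ℤ) ^ (e.2 * (∑ h, Fin.init q h - e.1)) •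
          (TensorProduct.lift ((meet br).compl₁₂
            (alternatingSumMap br (Fin.init q) (Fin.init C) e.1)
            (LinearMap.mulRight K (C (Fin.last (m + 1))) ∘ₗ
              GradedAlgebra.proj (fun i : ℕ => ⋀[K]^i V) (q (Fin.last (m + 1)) - e.2))) ∘ₗ
            coproduct K V) := by
  rw [alternatingSumMap, sum_boundedCompositions_succ]
  refine Finset.sum_congr rfl fun e _ => LinearMap.ext fun B => ?_
  rw [LinearMap.sum_apply, LinearMap.smul_apply, LinearMap.comp_apply]
  have key : ∀ i ∈ boundedCompositions (Fin.init q) e.1,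
      ((altSign q (Fin.snoc (α := fun _ => ℕ) i e.2) : ℤ) • sweedlerMap
        (fun h => q h - Fin.snoc (α := fun _ => ℕ) i e.2 h) (meetOfJoins br C)) B =
      (-1 : ℤ) ^ (e.2 * (∑ h, Fin.init q h - e.1)) • (altSign (Fin.init q) i : ℤ) •
        TensorProduct.lift ((meet br).compl₁₂
          (sweedlerMap (fun h => Fin.init q h - i h) (meetOfJoins br (Fin.init C)))
            (LinearMap.mulRight K (C (Fin.last (m + 1))) ∘ₗ
              GradedAlgebra.proj (fun i : ℕ => ⋀[K]^i V) (q (Fin.last (m + 1)) - e.2)))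
            (coproduct K V B) := by
    intro i hi
    have h₁ : (Fin.init fun h => q h - Fin.snoc (α := fun _ => ℕ) i e.2 h) =
        fun h => Fin.init q h - i h := by
      funext h; simp [Fin.init]
    rw [altSign_snoc q e.2 hi, sweedlerMap_succ, h₁, LinearMap.smul_apply, LinearMap.comp_apply,
      smul_smul, Fin.snoc_last]
    push_cast
    rfl
  rw [Finset.sum_congr rfl key, ← Finset.smul_sum]
  congr 1
  induction coproduct K V B with
  | zero => simp
  | add t u h₁ h₂ => simp only [map_add, smul_add, Finset.sum_add_distrib, h₁, h₂]
  | tmul x y =>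
    simp [alternatingSumMap, LinearMap.sum_apply, -zsmul_eq_mul]

/-! ### Bracket pairings with iterated meets. -/

theorem bracketForm_mul_of_mem {n q a : ℕ} (br : V [⋀^Fin n]→ₗ[K] K) (hq : q ≤ n)
    {C : ExteriorAlgebra K V} (hC : C ∈ ⋀[K]^(n - q) V) (ha : a ≠ q) {x : ExteriorAlgebra K V}
    (hx : x ∈ ⋀[K]^a V) : bracketForm br (x * C) = 0 :=
  bracketForm_of_mem br (by omega : a + (n - q) ≠ n) (SetLike.GradedMul.mul_mem hx hC)

/-- This expresses through brackets that the iterated meet has step $n-\sum q_h$, the form required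
by `meet_eq_bracketForm`. In the induction, a slice of $x$ survives only if its steps are
$q_1+\cdots+q_{r-1}$ and $q_r$. -/
theorem bracketForm_mul_iteratedMeet_of_mem [FiniteDimensional K V] {n : ℕ}
    (hn : Module.finrank K V = n) (br : V [⋀^Fin n]→ₗ[K] K) {m : ℕ} {q : Fin (m + 1) → ℕ}
    (hq : ∀ h, q h ≤ n) {C : Fin (m + 1) → ExteriorAlgebra K V}
    (hC : ∀ h, C h ∈ ⋀[K]^(n - q h) V) {a : ℕ} (ha : a ≠ ∑ h, q h) {x : ExteriorAlgebra K V}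
    (hx : x ∈ ⋀[K]^a V) : bracketForm br (x * iteratedMeet br m C) = 0 := by
  induction m generalizing a x with
  | zero => exact bracketForm_mul_of_mem br (hq 0) (hC 0) (by simpa using ha) hx
  | succ m ih =>
    rw [iteratedMeet_succ, bracketForm_mul_meet hn]
    refine homogeneousTensors_induction (P := fun t => LinearMap.mul' K K (TensorProduct.map
      (bracketForm br ∘ₗ LinearMap.mulRight K (iteratedMeet br m (Fin.init C)))
      (bracketForm br ∘ₗ LinearMap.mulRight K (C (Fin.last (m + 1)))) t) = 0)
      (by simp) (fun b c hbc y hy z hz => ?_)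
      (fun t u h₁ h₂ => by simp only [map_add, h₁, h₂, add_zero])
      (coproduct_mem_homogeneousTensors hx)
    simp only [TensorProduct.map_tmul, LinearMap.mul'_apply, LinearMap.comp_apply,
      LinearMap.mulRight_apply]
    by_cases hb : b = ∑ h, Fin.init q h
    · rw [bracketForm_mul_of_mem br (hq _) (hC (Fin.last (m + 1))) (a := c) ?_ hz, mul_zero]
      rintro rfl
      rw [Fin.sum_univ_castSucc] at ha
      exact ha (by rw [← hbc, hb]; rfl)
    · rw [ih (q := Fin.init q) (fun h => hq _) (C := Fin.init C) (fun h => hC _) hb hy, zero_mul]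

/-- With $x\otimes y$ from $\Delta A$ and $z\otimes w$ from $\Delta B$, the left side becomes a sum
of terms $\pm[xzD][ywc]$, where $D$ is the meet of all but the last $C_h$ and $c$ is the last. The
induction hypothesis applies to $[xzD]$. -/
theorem bracketForm_mul_mul_iteratedMeet [FiniteDimensional K V] {n : ℕ}
    (hn : Module.finrank K V = n) (br : V [⋀^Fin n]→ₗ[K] K) {m : ℕ} {q : Fin (m + 1) → ℕ}
    (hq : ∀ h, q h ≤ n) {C : Fin (m + 1) → ExteriorAlgebra K V}
    (hC : ∀ h, C h ∈ ⋀[K]^(n - q h) V) {s k : ℕ} (hsk : s + k = ∑ h, q h)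
    {A B : ExteriorAlgebra K V} (hA : A ∈ ⋀[K]^s V) (hB : B ∈ ⋀[K]^k V) :
    bracketForm br (A * B * iteratedMeet br m C) =
      bracketForm br (A * alternatingSumMap br q C s B) := by
  induction m generalizing s k A B with
  | zero =>
    rw [Fin.sum_univ_one] at hsk
    have h₁ : boundedCompositions q s = {fun _ => s} := by
      ext i
      rw [mem_boundedCompositions, Finset.mem_singleton, Fin.sum_univ_one]
      refine ⟨fun h => funext fun x => ?_, ?_⟩
      · rw [Fin.fin_one_eq_zero x]
        exact h.1
      · rintro rfl
        exact ⟨rfl, fun x => by rw [Fin.fin_one_eq_zero x]; exact Nat.le.intro hsk⟩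
    have h₂ : altSign q (fun _ => s) = 1 := by simp [altSign]
    rw [alternatingSumMap_apply, h₁, Finset.sum_singleton, h₂, one_smul, sweedlerMap_zero,
      show q 0 - s = k by omega, proj_of_mem hB, mul_assoc]
    rfl
  | succ m ih =>
    set D := iteratedMeet br m (Fin.init C) with hD
    set c := C (Fin.last (m + 1)) with hc
    set l := q (Fin.last (m + 1)) with hl
    have hsum : ∑ h, q h = ∑ h, Fin.init q h + l := Fin.sum_univ_castSucc _
    rw [iteratedMeet_succ, bracketForm_mul_meet hn, alternatingSumMap_succ, coproduct_mul,
      LinearMap.sum_apply, Finset.mul_sum, map_sum]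
    simp only [LinearMap.smul_apply, LinearMap.comp_apply]
    refine homogeneousTensors_induction (P := fun t => LinearMap.mul' K K (TensorProduct.map
      (bracketForm br ∘ₗ LinearMap.mulRight K D) (bracketForm br ∘ₗ LinearMap.mulRight K c)
      (gradedMul K V (coproduct K V A) t)) =
      ∑ e ∈ (Finset.HasAntidiagonal.antidiagonal s).filter (fun e => e.2 ≤ l),
        bracketForm br (A * (-1 : ℤ) ^ (e.2 * (∑ h, Fin.init q h - e.1)) •
          (TensorProduct.lift ((meet br).compl₁₂
            (alternatingSumMap br (Fin.init q) (Fin.init C) e.1)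
            (LinearMap.mulRight K c ∘ₗ
              GradedAlgebra.proj (fun i : ℕ => ⋀[K]^i V) (l - e.2))) t)))
      (by simp) (fun b d hbd z hz w hw => ?_)
      (fun t u h₁ h₂ => by
        simp only [map_add, smul_add, mul_add, Finset.sum_add_distrib, h₁, h₂])
      (coproduct_mem_homogeneousTensors hB)
    simp only [TensorProduct.lift.tmul, LinearMap.compl₁₂_apply, mul_smul_comm, map_zsmul,
      bracketForm_mul_meet hn]
    refine homogeneousTensors_induction (P := fun t => LinearMap.mul' K K (TensorProduct.map
      (bracketForm br ∘ₗ LinearMap.mulRight K D) (bracketForm br ∘ₗ LinearMap.mulRight K c)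
      (gradedMul K V t (z ⊗ₜ w))) =
      ∑ e ∈ (Finset.HasAntidiagonal.antidiagonal s).filter (fun e => e.2 ≤ l),
        (-1 : ℤ) ^ (e.2 * (∑ h, Fin.init q h - e.1)) • LinearMap.mul' K K (TensorProduct.map
          (bracketForm br ∘ₗ LinearMap.mulRight K
            (alternatingSumMap br (Fin.init q) (Fin.init C) e.1 z))
          (bracketForm br ∘ₗ LinearMap.mulRight K ((LinearMap.mulRight K c ∘ₗ
              GradedAlgebra.proj (fun i : ℕ => ⋀[K]^i V) (l - e.2)) w)) t))
      (by simp) (fun a j haj x hx y hy => ?_)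
      (fun t u h₁ h₂ => by
        simp only [map_add, LinearMap.add_apply, smul_add, Finset.sum_add_distrib, h₁, h₂])
      (coproduct_mem_homogeneousTensors hA)
    rw [gradedMul_tmul _ _ hy hz, Units.smul_def, map_zsmul, map_zsmul]
    simp only [TensorProduct.map_tmul, LinearMap.mul'_apply, LinearMap.comp_apply,
      LinearMap.mulRight_apply]
    have hyw : y * w ∈ ⋀[K]^(j + d) V := SetLike.GradedMul.mul_mem hy hw
    -- If $y\vee w$ has the step complementary to $c$, only the index $(a,j)$ survives the
    -- projection of $w$, and $a+b=q_1+\cdots+q_{r-1}$ turns the sign $(-1)^{jb}$ into that of the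
    -- recursion. Otherwise both sides vanish.
    by_cases hjd : j + d = l
    · rw [Finset.sum_eq_single_of_mem (a, j)
        (by rw [Finset.mem_filter, Finset.HasAntidiagonal.mem_antidiagonal]; exact ⟨haj, by omega⟩)]
      · rw [show l - j = d by omega, proj_of_mem hw, ← mul_assoc y,
          ← ih (q := Fin.init q) (fun h => hq _) (C := Fin.init C) (fun h => hC _)
            (by omega : a + b = ∑ h, Fin.init q h) hx hz,
          show ∑ h, Fin.init q h - a = b by omega]
        push_cast
        rfl
      · rintro ⟨a', j'⟩ he hne
        rw [Finset.mem_filter, Finset.HasAntidiagonal.mem_antidiagonal] at he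
        rw [Ne, Prod.mk.injEq] at hne
        rw [proj_of_mem_ne (by dsimp only at he ⊢; omega) hw]
        simp
    · rw [bracketForm_mul_of_mem br (hq _) (hC (Fin.last (m + 1))) hjd hyw, mul_zero, smul_zero]
      refine (Finset.sum_eq_zero ?_).symm
      rintro ⟨a', j'⟩ he
      by_cases hd : d = l - j'
      · rw [← hd, proj_of_mem hw, ← mul_assoc,
          bracketForm_mul_of_mem br (hq _) (hC (Fin.last (m + 1))) hjd hyw, mul_zero, smul_zero]
      · rw [proj_of_mem_ne hd hw]
        simp

/-- On pure tensors the joins $B_{(h)}\vee C_h$ have step $(q_h-i_h)+(n-q_h)=n-i_h$, so the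
vanishing for iterated meets applies with `i` in place of `q`. -/
theorem bracketForm_mul_sweedlerMap_of_mem [FiniteDimensional K V] {n : ℕ}
    (hn : Module.finrank K V = n) (br : V [⋀^Fin n]→ₗ[K] K) {m : ℕ} {q i : Fin (m + 1) → ℕ}
    (hq : ∀ h, q h ≤ n) {C : Fin (m + 1) → ExteriorAlgebra K V}
    (hC : ∀ h, C h ∈ ⋀[K]^(n - q h) V) (hi : ∀ h, i h ≤ q h) {a : ℕ} (ha : a ≠ ∑ h, i h)
    {x : ExteriorAlgebra K V} (hx : x ∈ ⋀[K]^a V) (B : ExteriorAlgebra K V) :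
    bracketForm br (x * sweedlerMap (fun h => q h - i h) (meetOfJoins br C) B) = 0 := by
  rw [sweedlerMap, LinearMap.comp_apply, LinearMap.comp_apply]
  induction iteratedCoproduct K V m B using PiTensorProduct.induction_on with
  | add t u h₁ h₂ => simp only [map_add, mul_add, h₁, h₂, add_zero]
  | smul_tprod r b =>
    rw [map_smul, map_smul, mul_smul_comm, map_smul, PiTensorProduct.map_tprod,
      PiTensorProduct.lift.tprod, meetOfJoins, MultilinearMap.compLinearMap_apply,
      bracketForm_mul_iteratedMeet_of_mem hn br (fun h => (hi h).trans (hq h)) (fun h => ?_) ha hx,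
      smul_zero]
    have := SetLike.GradedMul.mul_mem (A := fun i : ℕ => ⋀[K]^i V)
      (proj_mem (q h - i h) (b h)) (hC h)
    rwa [show q h - i h + (n - q h) = n - i h by have := hi h; have := hq h; omega] at this

end CayleyGrassmann

end

theorem proposition8 {K : Type*} [Field K] {V : Type*} [AddCommGroup V] [Module K V]
    [FiniteDimensional K V] (n : ℕ) (hn : Module.finrank K V = n)
    (br : V [⋀^Fin n]→ₗ[K] K) (hbr : br ≠ 0)
    (m : ℕ) (q : Fin (m + 1) → ℕ) (hq : ∀ h, 0 < q h) (hqn : ∀ h, q h < n)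
    (C : Fin (m + 1) → ExteriorAlgebra K V)
    (hC : ∀ h, CayleyGrassmann.IsExtensor (n - q h) (C h))
    (s k : ℕ) (hsk : s + k = ∑ h, q h)
    (A B : ExteriorAlgebra K V)
    (hA : CayleyGrassmann.IsExtensor s A) (hB : CayleyGrassmann.IsExtensor k B) :
    CayleyGrassmann.meet br (A * B) (CayleyGrassmann.iteratedMeet br m C) =
      CayleyGrassmann.meet br A
        (∑ i ∈ CayleyGrassmann.boundedCompositions q s,
          CayleyGrassmann.altSign q i •
            CayleyGrassmann.sweedlerSum (fun h => q h - i h)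
              (CayleyGrassmann.meetOfJoins br C) B) := by
  have hq' : ∀ h, q h ≤ n := fun h => (hqn h).le
  have hC' : ∀ h, C h ∈ ⋀[K]^(n - q h) V := fun h => (hC h).mem
  change _ = CayleyGrassmann.meet br A
    (∑ i ∈ CayleyGrassmann.boundedCompositions q s,
      CayleyGrassmann.altSign q i •
        CayleyGrassmann.sweedlerMap (fun h => q h - i h) (CayleyGrassmann.meetOfJoins br C) B)
  rw [← CayleyGrassmann.alternatingSumMap_apply,
    CayleyGrassmann.meet_eq_bracketForm br (p := ∑ h, q h)
      (hsk ▸ SetLike.GradedMul.mul_mem hA.mem hB.mem)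
      (fun a ha x hx => CayleyGrassmann.bracketForm_mul_iteratedMeet_of_mem hn br hq' hC' ha hx),
    CayleyGrassmann.meet_eq_bracketForm br hA.mem (fun a ha x hx => ?_),
    CayleyGrassmann.bracketForm_mul_mul_iteratedMeet hn br hq' hC' hsk hA.mem hB.mem]
  -- What remains is the complementarity condition for the right-hand meet: every summand of the
  -- signed sum pairs to zero with steps other than $s=\sum_h i_h$.
  rw [CayleyGrassmann.alternatingSumMap_apply, Finset.mul_sum, map_sum]
  refine Finset.sum_eq_zero fun i hi => ?_
  obtain ⟨rfl, hiq⟩ := CayleyGrassmann.mem_boundedCompositions.1 hi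
  rw [Units.smul_def, mul_smul_comm, map_zsmul,
    CayleyGrassmann.bracketForm_mul_sweedlerMap_of_mem hn br hq' hC' hiq ha hx, smul_zero]
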